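/- For $k,m\in\mathbb Z$ consider the dyadic interval $I=[2^{-k}m,2^{-k}(m+1))$ of $\mathbb R$, with length $|I|=2^{-k}$, and let $\mathbb D^0$ be the collection of all of them. Let $h_I$ be the $L^2$-normalised Haar function of $I$, equal to $|I|^{-1/2}$ on the left half of $I$, to $-|I|^{-1/2}$ on the right half and to $0$ elsewhere. Functions are real or complex valued, $\langle u,v\rangle=\int_{\mathbb R}uv\,dx$ (no conjugation), and for a bounded non-degenerate interval $Q$, $$\operatorname{osc}_Q(f)=\frac1{|Q|}\int_Q\Big|f-\frac1{|Q|}\int_Qf\Big|\,dx ,\qquad M^{\#}f(x)=\sup_{Q\ni x}\operatorname{osc}_Q(f),$$ the supremum being over all bounded non-degenerate intervals $Q$ containing $x$. A collection $\mathcal S\subset\mathbb D^0$ is $\eta$-sparse if there are pairwise disjoint measurable sets $E_Q\subset Q$, $Q\in\mathcal S$, with $|E_Q|\ge\eta|Q|$. (a) For every $\eta\in(0,1)$ there is a constant $C>0$ depending only on $\eta$ such that the following holds. Let $\mathscr I\subset\mathbb D^0$ be a collection of dyadic intervals (finite or infinite), let $(\varepsilon_I)_{I\in\mathscr I}$ be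 scalars with $|\varepsilon_I|\le A$ for all $I\in\mathscr I$, where $0\le A<\infty$, and let $f,g\in L^2(\mathbb R)$. Then the series $Tf=\sum_{I\in\mathscr I}\varepsilon_I\langle f,h_I\rangle h_I$ converges unconditionally in $L^2(\mathbb R)$, the series $\Lambda_{\mathscr I}(f,g)=\sum_{I\in\mathscr I}\varepsilon_I\langle f,h_I\rangle\langle g,h_I\rangle$ converges absolutely, $\langle Tf,g\rangle=\Lambda_{\mathscr I}(f,g)$, and there is an $\eta$-sparse collection $\mathcal S\subset\mathbb D^0$ (which may depend on $f$, $g$, $\mathscr I$ and $(\varepsilon_I)$) such that $$|\Lambda_{\mathscr I}(f,g)|\le C\,A\sum_{Q\in\mathcal S}\operatorname{osc}_Q(f)\,\operatorname{osc}_Q(g)\,|Q|,$$ where the sum on the right converges. (b) There is an absolute constant $C>0$ such that for all $f,g\in L^2(\mathbb R)$ $$\Big|\int_{\mathbb R}f\,g\,dx\Big|\le C\int_{\mathbb R}M^{\#}f\cdot M^{\#}g\,dx .$$ -/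

import Mathlib

open MeasureTheory Set
open scoped ENNReal

noncomputable section

namespace HaarSparse

/-- The dyadic interval `[2^(-k) m, 2^(-k) (m + 1))` of the real line, encoded by `k, m : ℤ`.
The encoding is injective, so sets of `DyadicInterval` are collections of standard dyadic
intervals. -/
structure DyadicInterval where
  k : ℤ
  m : ℤ

namespace DyadicInterval

/-- The length `2^(-k)`. -/
def length (I : DyadicInterval) : ℝ := (2 : ℝ) ^ (-I.k)

/-- The left endpoint `2^(-k) m`. -/
def left (I : DyadicInterval) : ℝ := I.length * I.m

/-- The midpoint. -/
def mid (I : DyadicInterval) : ℝ := I.left + I.length / 2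

/-- The right endpoint `2^(-k) (m + 1)`. -/
def right (I : DyadicInterval) : ℝ := I.left + I.length

/-- The interval as a subset of `ℝ`. -/
def toSet (I : DyadicInterval) : Set ℝ := Ico I.left I.right

end DyadicInterval

/-- The `L²`-normalised Haar function of `I`: it equals `|I|^(-1/2)` on the left half of `I`,
`-|I|^(-1/2)` on the right half, and `0` outside `I`. -/
def haar (𝕜 : Type*) [RCLike 𝕜] (I : DyadicInterval) : ℝ → 𝕜 :=
  (Ico I.left I.mid).indicator (fun _ => ((Real.sqrt I.length)⁻¹ : 𝕜)) -
    (Ico I.mid I.right).indicator (fun _ => ((Real.sqrt I.length)⁻¹ : 𝕜))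

theorem memLp_haar (𝕜 : Type*) [RCLike 𝕜] (I : DyadicInterval) :
    MemLp (haar 𝕜 I) 2 (volume : Measure ℝ) :=
  (memLp_indicator_const 2 measurableSet_Ico _ (Or.inr measure_Ico_lt_top.ne)).sub
    (memLp_indicator_const 2 measurableSet_Ico _ (Or.inr measure_Ico_lt_top.ne))

/-- The Haar function as an element of `L²(ℝ)`. -/
def haarLp (𝕜 : Type*) [RCLike 𝕜] (I : DyadicInterval) : Lp 𝕜 2 (volume : Measure ℝ) :=
  (memLp_haar 𝕜 I).toLp (haar 𝕜 I)

/-- The Haar coefficient `⟨f, h_I⟩ = ∫ f h_I` (`h_I` is real valued). -/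
def haarCoeff {𝕜 : Type*} [RCLike 𝕜] (f : ℝ → 𝕜) (I : DyadicInterval) : 𝕜 :=
  ∫ x, f x * haar 𝕜 I x

/-- The Haar multiplier `T f = ∑_{I ∈ 𝓘} ε_I ⟨f, h_I⟩ h_I`, the series being taken in `L²(ℝ)`. -/
def haarMultiplier {𝕜 : Type*} [RCLike 𝕜] (𝓘 : Set DyadicInterval) (ε : DyadicInterval → 𝕜)
    (f : Lp 𝕜 2 (volume : Measure ℝ)) : Lp 𝕜 2 (volume : Measure ℝ) :=
  ∑' I : 𝓘, (ε I * haarCoeff f I) • haarLp 𝕜 (I : DyadicInterval)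

/-- The bilinear form `Λ_𝓘(f, g) = ∑_{I ∈ 𝓘} ε_I ⟨f, h_I⟩ ⟨g, h_I⟩`. -/
def haarForm {𝕜 : Type*} [RCLike 𝕜] (𝓘 : Set DyadicInterval) (ε : DyadicInterval → 𝕜)
    (f g : ℝ → 𝕜) : 𝕜 :=
  ∑' I : 𝓘, ε I * haarCoeff f I * haarCoeff g I

/-- The `L¹` mean oscillation of `f` on `B`: the average over `B` of `|f - (average of f on B)|`. -/
def osc {𝕜 : Type*} [RCLike 𝕜] (f : ℝ → 𝕜) (B : Set ℝ) : ℝ :=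
  ⨍ x in B, ‖f x - ⨍ y in B, f y‖

/-- The Fefferman--Stein sharp maximal function: the supremum of the mean oscillations of `f` on
the bounded non-degenerate intervals that contain `x`. -/
def sharpMax {𝕜 : Type*} [RCLike 𝕜] (f : ℝ → 𝕜) (x : ℝ) : ℝ≥0∞ :=
  ⨆ (a : ℝ) (b : ℝ) (_ : a < b) (_ : x ∈ Icc a b), ENNReal.ofReal (osc f (Icc a b))

/-- `η`-sparse collections of dyadic intervals: there are pairwise disjoint measurable sets
`E_Q ⊆ Q`, `Q ∈ 𝓢`, with `|E_Q| ≥ η |Q|`. -/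
def IsSparse (η : ℝ) (𝓢 : Set DyadicInterval) : Prop :=
  ∃ E : DyadicInterval → Set ℝ,
    (∀ Q ∈ 𝓢, MeasurableSet (E Q) ∧ E Q ⊆ Q.toSet ∧
      ENNReal.ofReal (η * Q.length) ≤ volume (E Q)) ∧
    𝓢.PairwiseDisjoint E

end HaarSparse

end

/-! The Haar functions form an orthonormal basis of L², so ∫ f g is the form with every ε_I = 1, and
Bessel's inequality gives the convergence claims. If Λ ≠ 0, some finite partial sum exceeds |Λ|/2 in
modulus. It is therefore enough to bound finite sums of |⟨f,h_I⟩||⟨g,h_I⟩| with a constant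
independent of the finite set, and the sparse family can be finite.

On an interval Q, stop at the maximal dyadic I ⊆ Q where the mean of |f - f_Q| exceeds K osc_Q(f),
or likewise for g, with K = 2/(1-η). The stopped intervals cover at most (2/K)|Q| = (1-η)|Q|, so E_Q
can be their complement in Q. The unstopped squared coefficients of f sum to at most (2K)² osc_Q(f)²
|Q| (`goodSum_sq_le`), and similarly for g; Cauchy–Schwarz then bounds the unstopped products by
(2K)² osc_Q(f) osc_Q(g) |Q|. Stopped intervals are treated in the same way with fewer generations
left (`exists_isSparseSum_fullSum`).

For (b), take η = 1/2: on E_Q both oscillations are dominated by the sharp maximal functions, and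
the E_Q are disjoint (`ofReal_isSparseSum_le`). -/

noncomputable section

namespace HaarSparse

/-! ### Geometry of dyadic intervals -/

namespace DyadicInterval

/-- The left half of a dyadic interval. -/
def leftHalf (I : DyadicInterval) : DyadicInterval := ⟨I.k + 1, 2 * I.m⟩

/-- The right half of a dyadic interval. -/
def rightHalf (I : DyadicInterval) : DyadicInterval := ⟨I.k + 1, 2 * I.m + 1⟩

theorem length_pos (I : DyadicInterval) : 0 < I.length := zpow_pos (by norm_num) _

theorem length_eq_of_k_succ {I J : DyadicInterval} (h : J.k = I.k + 1) :
    J.length = I.length / 2 := by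
  rw [length, length, h, neg_add, ← sub_eq_add_neg, zpow_sub_one₀ (by norm_num)]
  rfl

theorem length_leftHalf (I : DyadicInterval) : I.leftHalf.length = I.length / 2 :=
  length_eq_of_k_succ rfl

theorem length_rightHalf (I : DyadicInterval) : I.rightHalf.length = I.length / 2 :=
  length_eq_of_k_succ rfl

theorem toSet_leftHalf (I : DyadicInterval) : I.leftHalf.toSet = Ico I.left I.mid := by
  have h1 : I.leftHalf.left = I.left := by
    rw [left, left, length_leftHalf, leftHalf]; push_cast; ring
  rw [toSet, right, h1, length_leftHalf, mid]

theorem toSet_rightHalf (I : DyadicInterval) : I.rightHalf.toSet = Ico I.mid I.right := by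
  have h1 : I.rightHalf.left = I.mid := by
    rw [mid, left, left, length_rightHalf, rightHalf]; push_cast; ring
  rw [toSet, right, h1, length_rightHalf, mid, right]; congr 1; ring

theorem left_lt_mid (I : DyadicInterval) : I.left < I.mid := by
  have := I.length_pos; rw [mid]; linarith

theorem mid_lt_right (I : DyadicInterval) : I.mid < I.right := by
  have := I.length_pos; rw [mid, right]; linarith

theorem left_lt_right (I : DyadicInterval) : I.left < I.right :=
  I.left_lt_mid.trans I.mid_lt_right

theorem toSet_halves (I : DyadicInterval) : I.leftHalf.toSet ∪ I.rightHalf.toSet = I.toSet := by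
  rw [toSet_leftHalf, toSet_rightHalf, toSet,
    Ico_union_Ico_eq_Ico I.left_lt_mid.le I.mid_lt_right.le]

theorem leftHalf_subset (I : DyadicInterval) : I.leftHalf.toSet ⊆ I.toSet :=
  I.toSet_halves ▸ subset_union_left

theorem rightHalf_subset (I : DyadicInterval) : I.rightHalf.toSet ⊆ I.toSet :=
  I.toSet_halves ▸ subset_union_right

theorem disjoint_halves (I : DyadicInterval) :
    Disjoint I.leftHalf.toSet I.rightHalf.toSet := by
  rw [toSet_leftHalf, toSet_rightHalf]
  exact Ico_disjoint_Ico_same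

theorem measurableSet_toSet (I : DyadicInterval) : MeasurableSet I.toSet := measurableSet_Ico

theorem volume_toSet (I : DyadicInterval) : volume I.toSet = ENNReal.ofReal I.length := by
  rw [toSet, Real.volume_Ico, right, add_sub_cancel_left]

theorem volume_real_toSet (I : DyadicInterval) : volume.real I.toSet = I.length := by
  rw [Measure.real, volume_toSet, ENNReal.toReal_ofReal I.length_pos.le]

theorem nonempty_toSet (I : DyadicInterval) : I.toSet.Nonempty :=
  nonempty_Ico.2 I.left_lt_right

/-- The dyadic interval of twice the length that contains a given one. -/
def parent (I : DyadicInterval) : DyadicInterval := ⟨I.k - 1, I.m / 2⟩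

theorem eq_half_parent (I : DyadicInterval) : I = I.parent.leftHalf ∨ I = I.parent.rightHalf := by
  obtain ⟨k, m⟩ := I
  simp only [parent, leftHalf, rightHalf, mk.injEq]
  omega

theorem subset_parent (I : DyadicInterval) : I.toSet ⊆ I.parent.toSet := by
  rcases I.eq_half_parent with h | h
  · exact (congrArg toSet h).trans_subset (leftHalf_subset _)
  · exact (congrArg toSet h).trans_subset (rightHalf_subset _)

theorem disjoint_of_k_eq {I J : DyadicInterval} (hk : I.k = J.k) (h : I ≠ J) :
    Disjoint I.toSet J.toSet := by
  rw [Set.disjoint_left]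
  rintro x ⟨h1, h2⟩ ⟨h3, h4⟩
  obtain ⟨k, m⟩ := I
  obtain ⟨k', m'⟩ := J
  obtain rfl : k = k' := hk
  have hl := length_pos ⟨k, m⟩
  simp only [right, left] at *
  have hl' : length ⟨k, m'⟩ = length ⟨k, m⟩ := rfl
  rw [hl'] at h3 h4
  have e1 : (m : ℝ) < m' + 1 := by
    by_contra! hc
    nlinarith
  have e2 : (m' : ℝ) < m + 1 := by
    by_contra! hc
    nlinarith
  have e1' : m < m' + 1 := by exact_mod_cast e1
  have e2' : m' < m + 1 := by exact_mod_cast e2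
  exact h (by rw [mk.injEq]; omega)

theorem exists_ancestor (J : DyadicInterval) (d : ℕ) :
    ∃ J' : DyadicInterval, J'.k = J.k - d ∧ J.toSet ⊆ J'.toSet := by
  induction d with
  | zero => exact ⟨J, by simp, subset_rfl⟩
  | succ d ih =>
    obtain ⟨J', h1, h2⟩ := ih
    refine ⟨J'.parent, ?_, h2.trans J'.subset_parent⟩
    simp only [parent, h1]; push_cast; ring

theorem subset_half_or_disjoint {I J : DyadicInterval} (h : I.k < J.k) :
    J.toSet ⊆ I.leftHalf.toSet ∨ J.toSet ⊆ I.rightHalf.toSet ∨ Disjoint I.toSet J.toSet := by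
  -- This ancestor lies one generation below `I`; its parent has the length of `I`, so it equals `I`
  -- or is disjoint from it.
  obtain ⟨J', h1, h2⟩ := J.exists_ancestor (J.k - I.k - 1).toNat
  have hk : J'.k = I.k + 1 := by omega
  by_cases hI : J'.parent = I
  · rcases J'.eq_half_parent with h3 | h3 <;> rw [hI] at h3 <;> subst h3
    · exact Or.inl h2
    · exact Or.inr (Or.inl h2)
  · refine Or.inr (Or.inr (.mono_right (h2.trans J'.subset_parent) (disjoint_of_k_eq ?_ (Ne.symm hI))))
    simp only [parent, hk]; ring

/-- `I.Below n J`: `J` is among the `n` generations of dyadic intervals starting with `I`. -/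
def Below : ℕ → DyadicInterval → DyadicInterval → Prop
  | 0, _, _ => False
  | n + 1, I, J => J = I ∨ Below n I.leftHalf J ∨ Below n I.rightHalf J

theorem Below.succ {n : ℕ} {I J : DyadicInterval} (h : Below n I J) : Below (n + 1) I J := by
  induction n generalizing I with
  | zero => exact h.elim
  | succ n ih =>
    rcases h with h | h | h
    · exact Or.inl h
    · exact Or.inr (Or.inl (ih h))
    · exact Or.inr (Or.inr (ih h))

theorem Below.mono {n m : ℕ} (hnm : n ≤ m) {I J : DyadicInterval} (h : Below n I J) :
    Below m I J := by
  induction m, hnm using Nat.le_induction with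
  | base => exact h
  | succ m _ ih => exact ih.succ

theorem exists_below (J : DyadicInterval) (d : ℕ) :
    ∃ I : DyadicInterval, I.k = J.k - d ∧ Below (d + 1) I J := by
  induction d with
  | zero => exact ⟨J, by simp, Or.inl rfl⟩
  | succ d ih =>
    obtain ⟨I, h1, h2⟩ := ih
    refine ⟨I.parent, ?_, ?_⟩
    · simp only [parent, h1]; push_cast; ring
    · rcases I.eq_half_parent with h3 | h3 <;> rw [h3] at h2
      · exact Or.inr (Or.inl h2)
      · exact Or.inr (Or.inr h2)

end DyadicInterval

/-! ### Sums over the dyadic tree and the stopping rule -/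

open DyadicInterval

/-- The sum of `w` over the first `n` generations of dyadic subintervals of `I`. -/
def fullSum (w : DyadicInterval → ℝ) : ℕ → DyadicInterval → ℝ
  | 0, _ => 0
  | n + 1, I => w I + fullSum w n I.leftHalf + fullSum w n I.rightHalf

open Classical in
/-- The sum of `w` over those of the first `n` generations of dyadic subintervals of `I` that are
not contained in an interval satisfying the halting condition. -/
def goodSum (halt : DyadicInterval → Prop) (w : DyadicInterval → ℝ) : ℕ → DyadicInterval → ℝ
  | 0, _ => 0
  | n + 1, I => if halt I then 0 else
      w I + goodSum halt w n I.leftHalf + goodSum halt w n I.rightHalf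

open Classical in
/-- The union of those of the first `n` generations of dyadic subintervals of `I` that satisfy the
halting condition. -/
def haltSet (halt : DyadicInterval → Prop) : ℕ → DyadicInterval → Set ℝ
  | 0, _ => ∅
  | n + 1, I => if halt I then I.toSet else
      haltSet halt n I.leftHalf ∪ haltSet halt n I.rightHalf

open Classical in
theorem sum_filter_below_le_fullSum {w : DyadicInterval → ℝ} (hw : ∀ I, 0 ≤ w I)
    (F : Finset DyadicInterval) (n : ℕ) (I : DyadicInterval) :
    ∑ J ∈ F with Below n I J, w J ≤ fullSum w n I := by
  induction n generalizing I with
  | zero =>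
    rw [Finset.filter_false_of_mem (p := Below 0 I) fun _ _ h => h]
    exact le_rfl
  | succ n ih =>
    have hsub : F.filter (Below (n + 1) I) ⊆
        ({I} ∪ F.filter (Below n I.leftHalf)) ∪ F.filter (Below n I.rightHalf) := by
      intro J
      rw [Finset.mem_filter, Finset.mem_union, Finset.mem_union, Finset.mem_singleton,
        Finset.mem_filter, Finset.mem_filter, Below]
      tauto
    have hun : ∀ s t : Finset DyadicInterval, ∑ J ∈ s ∪ t, w J ≤ ∑ J ∈ s, w J + ∑ J ∈ t, w J := by
      intro s t
      rw [← Finset.sum_union_inter]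
      exact le_add_of_nonneg_right (Finset.sum_nonneg fun J _ => hw J)
    calc ∑ J ∈ F with Below (n + 1) I J, w J
        ≤ ∑ J ∈ ({I} ∪ F.filter (Below n I.leftHalf)) ∪ F.filter (Below n I.rightHalf), w J :=
          Finset.sum_le_sum_of_subset_of_nonneg hsub fun J _ _ => hw J
      _ ≤ (w I + ∑ J ∈ F with Below n I.leftHalf J, w J) +
            ∑ J ∈ F with Below n I.rightHalf J, w J := by
          refine (hun _ _).trans (add_le_add_left ((hun _ _).trans ?_) _)
          rw [Finset.sum_singleton]
      _ ≤ fullSum w (n + 1) I := add_le_add (add_le_add_right (ih _) _) (ih _)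

theorem measurableSet_haltSet (halt : DyadicInterval → Prop) (n : ℕ) (I : DyadicInterval) :
    MeasurableSet (haltSet halt n I) := by
  induction n generalizing I with
  | zero => exact MeasurableSet.empty
  | succ n ih =>
    rw [haltSet]
    split_ifs
    · exact I.measurableSet_toSet
    · exact (ih _).union (ih _)

theorem haltSet_subset (halt : DyadicInterval → Prop) (n : ℕ) (I : DyadicInterval) :
    haltSet halt n I ⊆ I.toSet := by
  induction n generalizing I with
  | zero => exact empty_subset _
  | succ n ih =>
    rw [haltSet]
    split_ifs
    · exact subset_rfl
    · exact union_subset ((ih _).trans I.leftHalf_subset) ((ih _).trans I.rightHalf_subset)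

theorem setIntegral_toSet_eq_halves {E : Type*} [NormedAddCommGroup E] [NormedSpace ℝ E]
    {w : ℝ → E} {I : DyadicInterval} (hw : IntegrableOn w I.toSet) :
    ∫ x in I.toSet, w x = (∫ x in I.leftHalf.toSet, w x) + ∫ x in I.rightHalf.toSet, w x := by
  rw [← I.toSet_halves, setIntegral_union I.disjoint_halves I.rightHalf.measurableSet_toSet
    (hw.mono_set I.leftHalf_subset) (hw.mono_set I.rightHalf_subset)]

/-- Weak-type estimate: the first halting intervals on each branch are disjoint, and each is no
longer than its share of ∫ w. -/
theorem volume_haltSet_le {halt : DyadicInterval → Prop} {w : ℝ → ℝ} {Q : DyadicInterval}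
    (hw : IntegrableOn w Q.toSet) (hw0 : ∀ x, 0 ≤ w x)
    (h_halt : ∀ I : DyadicInterval, I.toSet ⊆ Q.toSet → halt I → I.length ≤ ∫ x in I.toSet, w x)
    (n : ℕ) {I : DyadicInterval} (hI : I.toSet ⊆ Q.toSet) :
    volume (haltSet halt n I) ≤ ENNReal.ofReal (∫ x in I.toSet, w x) := by
  induction n generalizing I with
  | zero => simp [haltSet]
  | succ n ih =>
    rw [haltSet]
    split_ifs with h
    · rw [volume_toSet]
      exact ENNReal.ofReal_le_ofReal (h_halt I hI h)
    · rw [setIntegral_toSet_eq_halves (hw.mono_set hI),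
        ENNReal.ofReal_add (integral_nonneg fun x => hw0 x) (integral_nonneg fun x => hw0 x)]
      exact (measure_union_le _ _).trans
        (add_le_add (ih (I.leftHalf_subset.trans hI)) (ih (I.rightHalf_subset.trans hI)))

/-- Cauchy–Schwarz with a parameter: for fixed t the inequality is linear in the three sums, so it
passes through the recursion. The optimisation in t is left to `le_of_forall_weighted`. -/
theorem two_mul_goodSum_mul_le (halt : DyadicInterval → Prop) (a b : DyadicInterval → ℝ) {t : ℝ}
    (ht : 0 < t) (n : ℕ) (I : DyadicInterval) :
    2 * goodSum halt (fun J => a J * b J) n I ≤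
      t * goodSum halt (fun J => a J ^ 2) n I + t⁻¹ * goodSum halt (fun J => b J ^ 2) n I := by
  induction n generalizing I with
  | zero => simp [goodSum]
  | succ n ih =>
    rw [goodSum, goodSum, goodSum]
    split_ifs
    · simp
    · have h1 := ih I.leftHalf
      have h2 := ih I.rightHalf
      have h3 : 2 * (a I * b I) ≤ t * a I ^ 2 + t⁻¹ * b I ^ 2 := by
        have h4 : 0 ≤ t⁻¹ * (t * a I - b I) ^ 2 := by positivity
        have h5 : t⁻¹ * (t * a I - b I) ^ 2 =
          t * a I ^ 2 + t⁻¹ * b I ^ 2 - 2 * (a I * b I) := by field_simp; ring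
        linarith
      linarith

/-! ### Haar coefficients and the square function bound -/

variable {𝕜 : Type*} [RCLike 𝕜]

theorem haarCoeff_eq {f : ℝ → 𝕜} {I : DyadicInterval} (hf : IntegrableOn f I.toSet) :
    haarCoeff f I = ((Real.sqrt I.length)⁻¹ : 𝕜) *
      ((∫ x in I.leftHalf.toSet, f x) - ∫ x in I.rightHalf.toSet, f x) := by
  have h1 : (fun x => f x * haar 𝕜 I x) = fun x =>
      I.leftHalf.toSet.indicator (fun x => f x * ((Real.sqrt I.length)⁻¹ : 𝕜)) x -
      I.rightHalf.toSet.indicator (fun x => f x * ((Real.sqrt I.length)⁻¹ : 𝕜)) x := by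
    funext x
    rw [haar, toSet_leftHalf, toSet_rightHalf, Pi.sub_apply, mul_sub]
    simp only [indicator_apply]
    split_ifs <;> simp
  rw [haarCoeff, h1, integral_sub, integral_indicator I.leftHalf.measurableSet_toSet,
    integral_indicator I.rightHalf.measurableSet_toSet, integral_mul_const, integral_mul_const]
  · ring
  · exact (integrable_indicator_iff I.leftHalf.measurableSet_toSet).2
      ((hf.mono_set I.leftHalf_subset).mul_const _)
  · exact (integrable_indicator_iff I.rightHalf.measurableSet_toSet).2
      ((hf.mono_set I.rightHalf_subset).mul_const _)

/-- Since h_I has mean zero, a constant can be subtracted from f; means of f - c then control the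
coefficients. -/
theorem norm_haarCoeff_sq {f : ℝ → 𝕜} {I : DyadicInterval} (hf : IntegrableOn f I.toSet) (c : 𝕜) :
    ‖haarCoeff f I‖ ^ 2 = ‖(∫ x in I.leftHalf.toSet, (f x - c)) -
      ∫ x in I.rightHalf.toSet, (f x - c)‖ ^ 2 / I.length := by
  have hc : ∀ J : DyadicInterval, IntegrableOn (fun _ : ℝ => c) J.toSet := fun J =>
    integrableOn_const (by rw [volume_toSet]; exact ENNReal.ofReal_ne_top)
  rw [haarCoeff_eq hf, integral_sub (hf.mono_set I.leftHalf_subset) (hc _),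
    integral_sub (hf.mono_set I.rightHalf_subset) (hc _), setIntegral_const, setIntegral_const,
    volume_real_toSet, volume_real_toSet, length_leftHalf, length_rightHalf, sub_sub_sub_cancel_right,
    norm_mul, norm_inv, RCLike.norm_ofReal, mul_pow, inv_pow, sq_abs, Real.sq_sqrt I.length_pos.le]
  ring

/-- The Bellman function argument: the square function of `f - c` over the good intervals is
controlled by the halting threshold. -/
theorem goodSum_sq_le {halt : DyadicInterval → Prop} {f : ℝ → 𝕜} {c : 𝕜} {s : ℝ}
    {Q : DyadicInterval} (hf : IntegrableOn f Q.toSet)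
    (h_halt : ∀ I : DyadicInterval, ¬ halt I → ∫ x in I.toSet, ‖f x - c‖ ≤ s * I.length)
    (n : ℕ) {I : DyadicInterval} (hI : I.toSet ⊆ Q.toSet)
    (hIs : ‖∫ x in I.toSet, (f x - c)‖ ≤ 2 * s * I.length) :
    goodSum halt (fun J => ‖haarCoeff f J‖ ^ 2) n I ≤
      (2 * s) ^ 2 * I.length - ‖∫ x in I.toSet, (f x - c)‖ ^ 2 / I.length := by
  -- Nonnegativity of the bound settles both ways the recursion ends: no generation left, or a
  -- halting interval.
  have hbase : ∀ J : DyadicInterval, ‖∫ x in J.toSet, (f x - c)‖ ≤ 2 * s * J.length →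
      0 ≤ (2 * s) ^ 2 * J.length - ‖∫ x in J.toSet, (f x - c)‖ ^ 2 / J.length := by
    intro J hJ
    rw [sub_nonneg, div_le_iff₀ J.length_pos]
    calc _ ≤ (2 * s * J.length) ^ 2 := by gcongr
      _ = _ := by ring
  induction n generalizing I with
  | zero => exact hbase I hIs
  | succ n ih =>
    rw [goodSum]
    split_ifs with h
    · exact hbase I hIs
    · have hc : ∀ J : DyadicInterval, IntegrableOn (fun _ : ℝ => c) J.toSet := fun J =>
        integrableOn_const (by rw [volume_toSet]; exact ENNReal.ofReal_ne_top)
      have hfI : IntegrableOn (fun x => f x - c) I.toSet := (hf.mono_set hI).sub (hc I)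
      -- A child has half the length of its non-halting parent, which is why `hIs` allows 2s and not
      -- s.
      have hchild : ∀ J : DyadicInterval, J.toSet ⊆ I.toSet → J.length = I.length / 2 →
          ‖∫ x in J.toSet, (f x - c)‖ ≤ 2 * s * J.length := by
        intro J hJ hJl
        calc ‖∫ x in J.toSet, (f x - c)‖ ≤ ∫ x in J.toSet, ‖f x - c‖ :=
              norm_integral_le_integral_norm _
          _ ≤ ∫ x in I.toSet, ‖f x - c‖ :=
              setIntegral_mono_set hfI.norm (ae_of_all _ fun x => norm_nonneg _)
                (LE.le.eventuallyLE hJ)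
          _ ≤ s * I.length := h_halt I h
          _ = 2 * s * J.length := by rw [hJl]; ring
      have h1 := ih (I.leftHalf_subset.trans hI) (hchild _ I.leftHalf_subset I.length_leftHalf)
      have h2 := ih (I.rightHalf_subset.trans hI) (hchild _ I.rightHalf_subset I.length_rightHalf)
      rw [norm_haarCoeff_sq (hf.mono_set hI) c, setIntegral_toSet_eq_halves hfI]
      rw [length_leftHalf] at h1
      rw [length_rightHalf] at h2
      set p := ∫ x in I.leftHalf.toSet, (f x - c)
      set q := ∫ x in I.rightHalf.toSet, (f x - c)
      have hpar := parallelogram_law_with_norm ℝ p q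
      have hl := I.length_pos
      -- With Φ(J) = |∫_J (f - c)|²/|J|, the parallelogram law makes the squared coefficient equal
      -- to Φ(left) + Φ(right) - Φ(I), so the sum telescopes.
      have key : ‖p - q‖ ^ 2 / I.length + ‖p + q‖ ^ 2 / I.length =
          ‖p‖ ^ 2 / (I.length / 2) + ‖q‖ ^ 2 / (I.length / 2) := by
        field_simp
        linarith
      linarith

/-! ### Gluing sparse families -/

/-- `s` is the sum of `v` over a finite `η`-sparse collection of dyadic intervals contained
in `V`. -/
def IsSparseSum (η : ℝ) (v : DyadicInterval → ℝ) (V : Set ℝ) (s : ℝ) : Prop :=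
  ∃ (S : Finset DyadicInterval) (E : DyadicInterval → Set ℝ),
    (∀ Q ∈ S, Q.toSet ⊆ V ∧ MeasurableSet (E Q) ∧ E Q ⊆ Q.toSet ∧
      ENNReal.ofReal (η * Q.length) ≤ volume (E Q)) ∧
    (S : Set DyadicInterval).PairwiseDisjoint E ∧ ∑ Q ∈ S, v Q = s

theorem IsSparseSum.empty (η : ℝ) (v : DyadicInterval → ℝ) (V : Set ℝ) : IsSparseSum η v V 0 :=
  ⟨∅, fun _ => ∅, by simp, by simp, by simp⟩

theorem IsSparseSum.union {η : ℝ} {v : DyadicInterval → ℝ} {V W : Set ℝ} {s t : ℝ}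
    (hs : IsSparseSum η v V s) (ht : IsSparseSum η v W t) (hVW : Disjoint V W) :
    IsSparseSum η v (V ∪ W) (s + t) := by
  classical
  obtain ⟨S, E, hE, hEd, rfl⟩ := hs
  obtain ⟨T, F, hF, hFd, rfl⟩ := ht
  have hST : ∀ Q ∈ T, Q ∉ S := by
    intro Q hQT hQS
    obtain ⟨x, hx⟩ := Q.nonempty_toSet
    exact Set.disjoint_left.1 hVW ((hE Q hQS).1 hx) ((hF Q hQT).1 hx)
  have hEV : ∀ Q ∈ S, E Q ⊆ V := fun Q hQ => (hE Q hQ).2.2.1.trans (hE Q hQ).1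
  have hFW : ∀ Q ∈ T, F Q ⊆ W := fun Q hQ => (hF Q hQ).2.2.1.trans (hF Q hQ).1
  have hdS : ∀ Q ∈ S, (if Q ∈ S then E Q else F Q) = E Q := fun Q hQ => if_pos hQ
  have hdT : ∀ Q ∈ T, (if Q ∈ S then E Q else F Q) = F Q := fun Q hQ => if_neg (hST Q hQ)
  refine ⟨S ∪ T, fun Q => if Q ∈ S then E Q else F Q, ?_, ?_, ?_⟩
  · intro Q hQ
    dsimp only
    rcases Finset.mem_union.1 hQ with h | h
    · rw [hdS Q h]
      exact ⟨(hE Q h).1.trans subset_union_left, (hE Q h).2⟩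
    · rw [hdT Q h]
      exact ⟨(hF Q h).1.trans subset_union_right, (hF Q h).2⟩
  · intro P hP Q hQ hPQ
    simp only [Function.onFun]
    rcases Finset.mem_union.1 hP with h | h <;> rcases Finset.mem_union.1 hQ with h' | h'
    · rw [hdS P h, hdS Q h']
      exact hEd h h' hPQ
    · rw [hdS P h, hdT Q h']
      exact hVW.mono (hEV P h) (hFW Q h')
    · rw [hdT P h, hdS Q h']
      exact hVW.symm.mono (hFW P h) (hEV Q h')
    · rw [hdT P h, hdT Q h']
      exact hFd h h' hPQ
  · exact Finset.sum_union (Finset.disjoint_right.2 hST)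

/-- The new interval receives Q \ V, which misses all earlier sets because they lie in V. -/
theorem IsSparseSum.insert {η : ℝ} (hη : 0 < η) {v : DyadicInterval → ℝ} {V : Set ℝ} {s : ℝ}
    (hs : IsSparseSum η v V s) {Q : DyadicInterval} (hV : MeasurableSet V) (hVQ : V ⊆ Q.toSet)
    (hvol : ENNReal.ofReal (η * Q.length) ≤ volume (Q.toSet \ V)) :
    IsSparseSum η v Q.toSet (v Q + s) := by
  classical
  obtain ⟨S, E, hE, hEd, rfl⟩ := hs
  -- Otherwise Q ⊆ V and Q \ V would be empty, against η > 0.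
  have hQS : Q ∉ S := by
    intro hQ
    rw [sdiff_eq_empty.2 (hE Q hQ).1, measure_empty, nonpos_iff_eq_zero,
      ENNReal.ofReal_eq_zero] at hvol
    exact absurd hvol (not_le.2 (mul_pos hη Q.length_pos))
  have hEV : ∀ P ∈ S, E P ⊆ V := fun P hP => (hE P hP).2.2.1.trans (hE P hP).1
  have hdS : ∀ P ∈ S, (if P ∈ S then E P else Q.toSet \ V) = E P := fun P hP => if_pos hP
  refine ⟨Insert.insert Q S, fun P => if P ∈ S then E P else Q.toSet \ V, ?_, ?_, ?_⟩
  · intro P hP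
    dsimp only
    rcases Finset.mem_insert.1 hP with rfl | h
    · rw [if_neg hQS]
      exact ⟨subset_rfl, P.measurableSet_toSet.diff hV, sdiff_subset, hvol⟩
    · rw [hdS P h]
      exact ⟨(hE P h).1.trans hVQ, (hE P h).2⟩
  · intro P hP P' hP' hne
    simp only [Function.onFun]
    rcases Finset.mem_insert.1 hP with rfl | h <;> rcases Finset.mem_insert.1 hP' with h' | h'
    · exact absurd h'.symm hne
    · rw [if_neg hQS, hdS P' h']
      exact disjoint_sdiff_left.mono_right (hEV P' h')
    · subst h'
      rw [if_neg hQS, hdS P h]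
      exact disjoint_sdiff_right.mono_left (hEV P h)
    · rw [hdS P h, hdS P' h']
      exact hEd h h' hne
  · exact Finset.sum_insert hQS

/-- The tree is cut at its first halting intervals. Each is handed to `H` with the generations that
remain below it; since halting may occur at any depth, `H` is needed for all m ≤ n. -/
theorem exists_isSparseSum_haltSet {η C : ℝ} {v w : DyadicInterval → ℝ}
    (halt : DyadicInterval → Prop) (n : ℕ)
    (H : ∀ m ≤ n, ∀ I : DyadicInterval, ∃ s, IsSparseSum η v I.toSet s ∧ fullSum w m I ≤ C * s)
    (I : DyadicInterval) :
    ∃ s, IsSparseSum η v (haltSet halt n I) s ∧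
      fullSum w n I ≤ goodSum halt w n I + C * s := by
  induction n generalizing I with
  | zero => exact ⟨0, IsSparseSum.empty _ _ _, by simp [fullSum, goodSum]⟩
  | succ n ih =>
    rw [haltSet, goodSum]
    split_ifs with h
    · obtain ⟨s, h1, h2⟩ := H (n + 1) le_rfl I
      exact ⟨s, h1, by rwa [zero_add]⟩
    · obtain ⟨s, h1, h2⟩ := ih (fun m hm => H m (hm.trans n.le_succ)) I.leftHalf
      obtain ⟨t, h3, h4⟩ := ih (fun m hm => H m (hm.trans n.le_succ)) I.rightHalf
      refine ⟨s + t, h1.union h3 (I.disjoint_halves.mono (haltSet_subset _ _ _)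
        (haltSet_subset _ _ _)), ?_⟩
      rw [fullSum]
      linarith

/-- As Q does not halt, the cutting starts at its halves with one generation fewer; this is what
closes the outer induction. -/
theorem exists_isSparseSum_of_halt {η C : ℝ} (hη : 0 < η) (hη1 : η < 1)
    {v w : DyadicInterval → ℝ} (n : ℕ)
    (H : ∀ m ≤ n, ∀ I : DyadicInterval, ∃ s, IsSparseSum η v I.toSet s ∧ fullSum w m I ≤ C * s)
    {halt : DyadicInterval → Prop} {Q : DyadicInterval} (hQ : ¬ halt Q)
    (hvol : volume (haltSet halt (n + 1) Q) ≤ ENNReal.ofReal ((1 - η) * Q.length))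
    (hgood : goodSum halt w (n + 1) Q ≤ C * v Q) :
    ∃ s, IsSparseSum η v Q.toSet s ∧ fullSum w (n + 1) Q ≤ C * s := by
  obtain ⟨s, h1, h2⟩ := exists_isSparseSum_haltSet halt n H Q.leftHalf
  obtain ⟨t, h3, h4⟩ := exists_isSparseSum_haltSet halt n H Q.rightHalf
  have h5 := h1.union h3 (Q.disjoint_halves.mono (haltSet_subset _ _ _) (haltSet_subset _ _ _))
  have h6 : haltSet halt (n + 1) Q =
      haltSet halt n Q.leftHalf ∪ haltSet halt n Q.rightHalf := by rw [haltSet, if_neg hQ]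
  rw [← h6] at h5
  refine ⟨v Q + (s + t), h5.insert hη (measurableSet_haltSet _ _ _) (haltSet_subset _ _ _) ?_, ?_⟩
  · rw [measure_sdiff (haltSet_subset _ _ _) (measurableSet_haltSet _ _ _).nullMeasurableSet
      (hvol.trans_lt ENNReal.ofReal_lt_top).ne, volume_toSet]
    refine le_trans ?_ (tsub_le_tsub_left hvol _)
    rw [← ENNReal.ofReal_sub _ (mul_nonneg (by linarith) Q.length_pos.le)]
    exact ENNReal.ofReal_le_ofReal (le_of_eq (by ring))
  · rw [goodSum, if_neg hQ] at hgood
    rw [fullSum]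
    linarith

/-! ### Oscillations and the stopping argument on one interval -/

theorem osc_nonneg (f : ℝ → 𝕜) (B : Set ℝ) : 0 ≤ osc f B := by
  rw [osc, setAverage_eq]
  exact smul_nonneg (by positivity) (integral_nonneg fun x => norm_nonneg _)

theorem setIntegral_norm_sub_average (f : ℝ → 𝕜) (Q : DyadicInterval) :
    ∫ x in Q.toSet, ‖f x - ⨍ y in Q.toSet, f y‖ = osc f Q.toSet * Q.length := by
  rw [osc, setAverage_eq volume (fun x => ‖f x - ⨍ y in Q.toSet, f y‖), volume_real_toSet,
    smul_eq_mul, mul_comm, mul_inv_cancel_left₀ Q.length_pos.ne']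

/-- The optimal weight is t = y/x; shifting both by δ > 0 avoids vanishing denominators, and then δ
→ 0. -/
theorem le_of_forall_weighted {G M x y : ℝ} (hM : 0 ≤ M) (hx : 0 ≤ x) (hy : 0 ≤ y)
    (h : ∀ t > 0, 2 * G ≤ t * (M * x ^ 2) + t⁻¹ * (M * y ^ 2)) : G ≤ M * (x * y) := by
  have key : ∀ δ > 0, G ≤ M * ((x + δ) * (y + δ)) := by
    intro δ hδ
    have hx' : 0 < x + δ := by linarith
    have hy' : 0 < y + δ := by linarith
    have h1 := h ((y + δ) / (x + δ)) (by positivity)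
    have h2 : (y + δ) / (x + δ) * (M * x ^ 2) ≤ (y + δ) / (x + δ) * (M * (x + δ) ^ 2) := by
      gcongr; linarith
    have h3 : ((y + δ) / (x + δ))⁻¹ * (M * y ^ 2) ≤
        ((y + δ) / (x + δ))⁻¹ * (M * (y + δ) ^ 2) := by
      gcongr; linarith
    have h4 : (y + δ) / (x + δ) * (M * (x + δ) ^ 2) = M * ((x + δ) * (y + δ)) := by
      field_simp
    have h5 : ((y + δ) / (x + δ))⁻¹ * (M * (y + δ) ^ 2) = M * ((x + δ) * (y + δ)) := by
      field_simp
    linarith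
  have hcont : Continuous fun δ : ℝ => M * ((x + δ) * (y + δ)) := by fun_prop
  have hlim := (hcont.tendsto 0).mono_left (nhdsWithin_le_nhds (s := Ioi 0))
  simp only [add_zero] at hlim
  exact ge_of_tendsto hlim (eventually_mem_nhdsWithin.mono key)

theorem length_le_of_lt_setIntegral {K x : ℝ} (hK : 0 < K) (hx : 0 ≤ x) {F : ℝ → ℝ}
    {I Q : DyadicInterval} (hF0 : ∀ y, 0 ≤ F y) (hF : IntegrableOn F Q.toSet)
    (hFQ : ∫ y in Q.toSet, F y = x * Q.length) (hI : I.toSet ⊆ Q.toSet)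
    (h : K * x * I.length < ∫ y in I.toSet, F y) :
    I.length ≤ ∫ y in I.toSet, (K * x)⁻¹ * F y := by
  -- For zero oscillation `(K * x)⁻¹` is 0 by convention, but then F has integral 0 over Q and
  -- halting is impossible.
  rcases hx.eq_or_lt with rfl | hx
  · have h1 := setIntegral_mono_set hF (ae_of_all _ hF0) (LE.le.eventuallyLE hI)
    rw [hFQ] at h1
    simp only [mul_zero, zero_mul] at h h1
    exact absurd h (not_lt.2 h1)
  · rw [integral_const_mul, inv_mul_eq_div, le_div_iff₀ (by positivity)]
    linarith

/-- Sparse domination of a finite portion of the Haar expansion. -/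
theorem exists_isSparseSum_fullSum {η : ℝ} (hη : 0 < η) (hη1 : η < 1) {f g : ℝ → 𝕜}
    (hf : ∀ I : DyadicInterval, IntegrableOn f I.toSet)
    (hg : ∀ I : DyadicInterval, IntegrableOn g I.toSet) (n : ℕ) :
    ∀ Q : DyadicInterval, ∃ s,
      IsSparseSum η (fun I => osc f I.toSet * osc g I.toSet * I.length) Q.toSet s ∧
      fullSum (fun I => ‖haarCoeff f I‖ * ‖haarCoeff g I‖) n Q ≤
        (2 * (2 / (1 - η))) ^ 2 * s := by
  induction n using Nat.strong_induction_on with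
  | _ n ih =>
  intro Q
  obtain _ | n := n
  · exact ⟨0, IsSparseSum.empty _ _ _, by simp [fullSum]⟩
  have hη' : 0 < 1 - η := by linarith
  -- Halting through f and through g costs at most |Q|/K each, and 2/K = 1 - η.
  set K : ℝ := 2 / (1 - η) with hK
  have hK0 : 0 < K := by positivity
  have hK1 : 1 ≤ K := by rw [hK, le_div_iff₀ hη']; linarith
  have hl := Q.length_pos
  set c := ⨍ y in Q.toSet, f y with hc
  set d := ⨍ y in Q.toSet, g y with hd
  set x := osc f Q.toSet with hx
  set y := osc g Q.toSet with hy
  have hx0 : 0 ≤ x := osc_nonneg _ _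
  have hy0 : 0 ≤ y := osc_nonneg _ _
  have hfx : ∫ z in Q.toSet, ‖f z - c‖ = x * Q.length := setIntegral_norm_sub_average f Q
  have hgy : ∫ z in Q.toSet, ‖g z - d‖ = y * Q.length := setIntegral_norm_sub_average g Q
  have hcon : ∀ c : 𝕜, IntegrableOn (fun _ : ℝ => c) Q.toSet := fun c =>
    integrableOn_const (by rw [volume_toSet]; exact ENNReal.ofReal_ne_top)
  have hfi : IntegrableOn (fun z => ‖f z - c‖) Q.toSet := ((hf Q).sub (hcon c)).norm
  have hgi : IntegrableOn (fun z => ‖g z - d‖) Q.toSet := ((hg Q).sub (hcon d)).norm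
  set halt : DyadicInterval → Prop := fun I =>
    K * x * I.length < (∫ z in I.toSet, ‖f z - c‖) ∨
      K * y * I.length < ∫ z in I.toSet, ‖g z - d‖ with h_halt
  have hfQ : x * Q.length ≤ K * x * Q.length := by
    rw [mul_assoc]; exact le_mul_of_one_le_left (by positivity) hK1
  have hgQ : y * Q.length ≤ K * y * Q.length := by
    rw [mul_assoc]; exact le_mul_of_one_le_left (by positivity) hK1
  have hQ : ¬ halt Q := by
    simp only [h_halt, hfx, hgy, not_or, not_lt]
    exact ⟨hfQ, hgQ⟩
  refine exists_isSparseSum_of_halt hη hη1 n (fun m hm I => ih m (by omega) I) hQ ?_ ?_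
  -- The sum of these two weights serves both halting rules: its integral is at least |I| over a
  -- halting I and at most (2/K)|Q| over Q.
  · have hw1 : IntegrableOn (fun z => (K * x)⁻¹ * ‖f z - c‖) Q.toSet := hfi.const_mul _
    have hw2 : IntegrableOn (fun z => (K * y)⁻¹ * ‖g z - d‖) Q.toSet := hgi.const_mul _
    have hn1 : ∀ z, 0 ≤ (K * x)⁻¹ * ‖f z - c‖ := fun z => by positivity
    have hn2 : ∀ z, 0 ≤ (K * y)⁻¹ * ‖g z - d‖ := fun z => by positivity
    refine (volume_haltSet_le (hw1.add hw2) (fun z => add_nonneg (hn1 z) (hn2 z)) ?_ _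
      subset_rfl).trans (ENNReal.ofReal_le_ofReal ?_)
    · intro I hI hsI
      simp only [Pi.add_apply]
      rw [integral_add (hw1.mono_set hI) (hw2.mono_set hI)]
      rcases hsI with h | h
      · have := length_le_of_lt_setIntegral hK0 hx0 (fun z => norm_nonneg (f z - c)) hfi hfx hI h
        have h0 : 0 ≤ ∫ z in I.toSet, (K * y)⁻¹ * ‖g z - d‖ := integral_nonneg hn2
        linarith
      · have := length_le_of_lt_setIntegral hK0 hy0 (fun z => norm_nonneg (g z - d)) hgi hgy hI h
        have h0 : 0 ≤ ∫ z in I.toSet, (K * x)⁻¹ * ‖f z - c‖ := integral_nonneg hn1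
        linarith
    · have hb : ∀ u : ℝ, 0 ≤ u → (K * u)⁻¹ * (u * Q.length) ≤ K⁻¹ * Q.length := by
        intro u hu
        rcases hu.eq_or_lt with rfl | hu
        · simp only [zero_mul, mul_zero]; positivity
        · exact le_of_eq (by field_simp)
      simp only [Pi.add_apply]
      rw [integral_add hw1 hw2, integral_const_mul, integral_const_mul, hfx, hgy]
      have h1 := hb x hx0
      have h2 := hb y hy0
      have h3 : (1 - η) * Q.length = K⁻¹ * Q.length + K⁻¹ * Q.length := by
        rw [hK]; field_simp; ring
      linarith
  · have hsq : ∀ {e : ℝ → 𝕜} {b : 𝕜} {u : ℝ}, 0 ≤ u →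
        (∀ I : DyadicInterval, IntegrableOn e I.toSet) →
        (∫ z in Q.toSet, ‖e z - b‖ = u * Q.length) →
        (∀ I : DyadicInterval, ¬ halt I → ∫ z in I.toSet, ‖e z - b‖ ≤ K * u * I.length) →
        goodSum halt (fun J => ‖haarCoeff e J‖ ^ 2) (n + 1) Q ≤
          (2 * K) ^ 2 * Q.length * u ^ 2 := by
      intro e b u hu he heu hns
      refine (goodSum_sq_le (he Q) hns (n + 1) subset_rfl ?_).trans ?_
      · refine (norm_integral_le_integral_norm _).trans (heu.trans_le ?_)
        nlinarith [mul_nonneg hu hl.le]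
      · have : 0 ≤ ‖∫ z in Q.toSet, (e z - b)‖ ^ 2 / Q.length := by positivity
        linarith
    have h1 := hsq hx0 hf hfx fun I hI => not_lt.1 fun h => hI (Or.inl h)
    have h2 := hsq hy0 hg hgy fun I hI => not_lt.1 fun h => hI (Or.inr h)
    have h3 : goodSum halt (fun I => ‖haarCoeff f I‖ * ‖haarCoeff g I‖) (n + 1) Q ≤
        ((2 * K) ^ 2 * Q.length) * (x * y) := by
      refine le_of_forall_weighted (by positivity) hx0 hy0 fun t ht => ?_
      refine (two_mul_goodSum_mul_le halt (fun I => ‖haarCoeff f I‖) (fun I => ‖haarCoeff g I‖)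
        ht (n + 1) Q).trans ?_
      gcongr
    refine h3.trans (le_of_eq ?_)
    simp only [← hx, ← hy]
    ring

/-! ### From one interval to finite sets of intervals -/

theorem exists_isSparseSum_finset {η C : ℝ} {v w : DyadicInterval → ℝ} {n : ℕ}
    (H : ∀ I : DyadicInterval, ∃ s, IsSparseSum η v I.toSet s ∧ fullSum w n I ≤ C * s)
    (k : ℤ) (R : Finset DyadicInterval) (hR : ∀ I ∈ R, I.k = k) :
    ∃ s, IsSparseSum η v (⋃ I ∈ R, I.toSet) s ∧ ∑ I ∈ R, fullSum w n I ≤ C * s := by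
  classical
  induction R using Finset.induction_on with
  | empty => exact ⟨0, IsSparseSum.empty _ _ _, by simp⟩
  | insert J R hJ ih =>
    obtain ⟨s, h1, h2⟩ := ih fun I hI => hR I (Finset.mem_insert_of_mem hI)
    obtain ⟨t, h3, h4⟩ := H J
    refine ⟨t + s, ?_, ?_⟩
    · rw [Finset.set_biUnion_insert]
      refine h3.union h1 ?_
      simp only [disjoint_iUnion_right]
      intro I hI
      refine disjoint_of_k_eq ?_ fun h => hJ (h ▸ hI)
      rw [hR I (Finset.mem_insert_of_mem hI), hR J (Finset.mem_insert_self _ _)]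
    · rw [Finset.sum_insert hJ, mul_add]
      exact add_le_add h4 h2

/-- Sparse domination of finitely many terms of the Haar expansion of `∫ f g`. -/
theorem exists_isSparseSum_sum {η : ℝ} (hη : 0 < η) (hη1 : η < 1) {f g : ℝ → 𝕜}
    (hf : ∀ I : DyadicInterval, IntegrableOn f I.toSet)
    (hg : ∀ I : DyadicInterval, IntegrableOn g I.toSet) (F : Finset DyadicInterval) :
    ∃ s, IsSparseSum η (fun I => osc f I.toSet * osc g I.toSet * I.length) univ s ∧
      ∑ I ∈ F, ‖haarCoeff f I‖ * ‖haarCoeff g I‖ ≤ (2 * (2 / (1 - η))) ^ 2 * s := by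
  classical
  have hw : ∀ I : DyadicInterval, 0 ≤ ‖haarCoeff f I‖ * ‖haarCoeff g I‖ := fun I => by positivity
  obtain ⟨k, hk⟩ : ∃ k : ℤ, ∀ I ∈ F, k ≤ I.k := by
    obtain ⟨k, hk⟩ := (F.image DyadicInterval.k).bddBelow
    exact ⟨k, fun I hI => hk (Finset.mem_coe.2 (Finset.mem_image_of_mem _ hI))⟩
  obtain ⟨l, hl⟩ : ∃ l : ℤ, ∀ I ∈ F, I.k ≤ l := by
    obtain ⟨k, hk⟩ := (F.image DyadicInterval.k).bddAbove
    exact ⟨k, fun I hI => hk (Finset.mem_coe.2 (Finset.mem_image_of_mem _ hI))⟩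
  -- The extra 1 counts the top generation k itself.
  set n : ℕ := (l - k).toNat + 1 with hn
  have hanc : ∀ J : DyadicInterval, ∃ I : DyadicInterval, J ∈ F → I.k = k ∧ Below n I J := by
    intro J
    obtain ⟨I, h1, h2⟩ := J.exists_below (J.k - k).toNat
    refine ⟨I, fun hJ => ?_⟩
    have := hk J hJ
    have := hl J hJ
    exact ⟨by omega, h2.mono (by omega)⟩
  choose top htop using hanc
  obtain ⟨s, h1, h2⟩ := exists_isSparseSum_finset
    (exists_isSparseSum_fullSum hη hη1 hf hg n) k (F.image top) (by
      intro I hI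
      obtain ⟨J, hJ, rfl⟩ := Finset.mem_image.1 hI
      exact (htop J hJ).1)
  obtain ⟨S, E, hE, hEd, hs⟩ := h1
  refine ⟨s, ⟨S, E, fun Q hQ => ⟨subset_univ _, (hE Q hQ).2⟩, hEd, hs⟩, le_trans ?_ h2⟩
  -- Group F by ancestor of generation k; each group lies in the n generations starting there.
  rw [← Finset.sum_fiberwise_of_maps_to (fun J hJ => Finset.mem_image_of_mem top hJ)]
  refine Finset.sum_le_sum fun I _ => le_trans ?_ (sum_filter_below_le_fullSum hw F n I)
  refine Finset.sum_le_sum_of_subset_of_nonneg ?_ fun J _ _ => hw J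
  intro J hJ
  rw [Finset.mem_filter] at hJ ⊢
  exact ⟨hJ.1, hJ.2 ▸ (htop J hJ.1).2⟩

/-! ### The Haar system as an orthonormal basis -/

open Filter Topology

theorem haar_of_mem_leftHalf {I : DyadicInterval} {x : ℝ} (h : x ∈ I.leftHalf.toSet) :
    haar 𝕜 I x = ((Real.sqrt I.length)⁻¹ : 𝕜) := by
  have h' := Set.disjoint_left.1 I.disjoint_halves h
  rw [toSet_leftHalf] at h
  rw [toSet_rightHalf] at h'
  rw [haar, Pi.sub_apply, indicator_of_mem h, indicator_of_notMem h', sub_zero]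

theorem haar_of_mem_rightHalf {I : DyadicInterval} {x : ℝ} (h : x ∈ I.rightHalf.toSet) :
    haar 𝕜 I x = -((Real.sqrt I.length)⁻¹ : 𝕜) := by
  have h' := Set.disjoint_right.1 I.disjoint_halves h
  rw [toSet_rightHalf] at h
  rw [toSet_leftHalf] at h'
  rw [haar, Pi.sub_apply, indicator_of_mem h, indicator_of_notMem h', zero_sub]

theorem haar_of_notMem {I : DyadicInterval} {x : ℝ} (h : x ∉ I.toSet) : haar 𝕜 I x = 0 := by
  have h1 := fun h' => h (I.leftHalf_subset h')
  have h2 := fun h' => h (I.rightHalf_subset h')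
  rw [toSet_leftHalf] at h1
  rw [toSet_rightHalf] at h2
  rw [haar, Pi.sub_apply, indicator_of_notMem h1, indicator_of_notMem h2, sub_zero]

theorem conj_haar (I : DyadicInterval) (x : ℝ) :
    (starRingEnd 𝕜) (haar 𝕜 I x) = haar 𝕜 I x := by
  rw [haar, Pi.sub_apply]
  simp only [indicator_apply]
  split_ifs <;> simp

theorem integrableOn_toSet {f : ℝ → 𝕜} (hf : MemLp f 2 (volume : Measure ℝ))
    (I : DyadicInterval) : IntegrableOn f I.toSet := by
  have : IsFiniteMeasure (volume.restrict I.toSet) :=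
    ⟨by rw [Measure.restrict_apply_univ, volume_toSet]; exact ENNReal.ofReal_lt_top⟩
  exact (hf.restrict I.toSet).integrable (by norm_num)

theorem haarCoeff_of_const {f : ℝ → 𝕜} {c : 𝕜} {I : DyadicInterval} (h : ∀ x ∈ I.toSet, f x = c) :
    haarCoeff f I = 0 := by
  have hf : IntegrableOn f I.toSet :=
    (integrableOn_const (C := c) (by rw [volume_toSet]; exact ENNReal.ofReal_ne_top)).congr_fun
      (fun x hx => (h x hx).symm) I.measurableSet_toSet
  rw [haarCoeff_eq hf,
    setIntegral_congr_fun I.leftHalf.measurableSet_toSet fun x hx => h x (I.leftHalf_subset hx),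
    setIntegral_congr_fun I.rightHalf.measurableSet_toSet fun x hx => h x (I.rightHalf_subset hx),
    setIntegral_const, setIntegral_const, volume_real_toSet, volume_real_toSet, length_leftHalf,
    length_rightHalf, sub_self, mul_zero]

/-- If the supports meet, the coarser function is constant on the finer interval, where the finer
one has mean zero. -/
theorem haarCoeff_haar_of_ne {I J : DyadicInterval} (h : I ≠ J) :
    haarCoeff (haar 𝕜 I) J = 0 := by
  have hlt : ∀ {I J : DyadicInterval}, I.k < J.k → haarCoeff (haar 𝕜 I) J = 0 := by
    intro I J hk
    rcases subset_half_or_disjoint hk with h1 | h1 | h1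
    · exact haarCoeff_of_const fun x hx => haar_of_mem_leftHalf (h1 hx)
    · exact haarCoeff_of_const fun x hx => haar_of_mem_rightHalf (h1 hx)
    · exact haarCoeff_of_const fun x hx => haar_of_notMem (Set.disjoint_right.1 h1 hx)
  rcases lt_trichotomy I.k J.k with hk | hk | hk
  · exact hlt hk
  · exact haarCoeff_of_const fun x hx =>
      haar_of_notMem (Set.disjoint_right.1 (disjoint_of_k_eq hk h) hx)
  · rw [← hlt hk, haarCoeff, haarCoeff]
    simp_rw [mul_comm]

theorem haarCoeff_haar_self (I : DyadicInterval) : haarCoeff (haar 𝕜 I) I = 1 := by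
  rw [haarCoeff_eq (integrableOn_toSet (memLp_haar 𝕜 I) I),
    setIntegral_congr_fun I.leftHalf.measurableSet_toSet fun x hx => haar_of_mem_leftHalf hx,
    setIntegral_congr_fun I.rightHalf.measurableSet_toSet fun x hx => haar_of_mem_rightHalf hx,
    setIntegral_const, setIntegral_const, volume_real_toSet, volume_real_toSet, length_leftHalf,
    length_rightHalf, smul_neg, sub_neg_eq_add, ← add_smul, add_halves, RCLike.real_smul_eq_coe_mul]
  have h1 : (Real.sqrt I.length : 𝕜) * (Real.sqrt I.length : 𝕜) = (I.length : 𝕜) := by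
    rw [← RCLike.ofReal_mul, Real.mul_self_sqrt I.length_pos.le]
  have h2 : (Real.sqrt I.length : 𝕜) ≠ 0 :=
    RCLike.ofReal_ne_zero.2 (Real.sqrt_pos.2 I.length_pos).ne'
  rw [← h1]
  field_simp

theorem haarCoeff_congr {f g : ℝ → 𝕜} (h : f =ᵐ[volume] g) (I : DyadicInterval) :
    haarCoeff f I = haarCoeff g I :=
  integral_congr_ae (h.mono fun x hx => by simp only [hx])

theorem inner_haarLp (I : DyadicInterval) (f : Lp 𝕜 2 (volume : Measure ℝ)) :
    inner 𝕜 (haarLp 𝕜 I) f = haarCoeff f I := by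
  rw [L2.inner_def, haarCoeff]
  refine integral_congr_ae ((memLp_haar 𝕜 I).coeFn_toLp.mono fun x hx => ?_)
  rw [haarLp] at *
  simp only [RCLike.inner_apply, hx, conj_haar]

theorem orthonormal_haarLp : Orthonormal 𝕜 (haarLp 𝕜) := by
  classical
  rw [orthonormal_iff_ite]
  intro I J
  rw [inner_haarLp, haarLp, haarCoeff_congr (memLp_haar 𝕜 J).coeFn_toLp]
  split_ifs with h
  · rw [h, haarCoeff_haar_self]
  · exact haarCoeff_haar_of_ne (Ne.symm h)

/-- The pairing is bilinear but the inner product is conjugate-linear in its first argument, hence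
the `star`. -/
theorem integral_mul_eq_inner_star (u g : Lp 𝕜 2 (volume : Measure ℝ)) :
    ∫ x, u x * g x = inner 𝕜 (star g) u := by
  rw [L2.inner_def]
  refine integral_congr_ae ((Lp.coeFn_star g).mono fun x hx => ?_)
  simp only [RCLike.inner_apply, hx, Pi.star_apply, RCLike.star_def, RCLike.conj_conj]

theorem inner_star_haarLp (g : Lp 𝕜 2 (volume : Measure ℝ)) (I : DyadicInterval) :
    inner 𝕜 (star g) (haarLp 𝕜 I) = haarCoeff g I := by
  rw [← integral_mul_eq_inner_star, haarCoeff]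
  refine integral_congr_ae ((memLp_haar 𝕜 I).coeFn_toLp.mono fun x hx => ?_)
  rw [haarLp] at *
  simp only [hx, mul_comm]

theorem norm_setIntegral_toSet_sq_le (f : Lp 𝕜 2 (volume : Measure ℝ)) (I : DyadicInterval) :
    ‖∫ x in I.toSet, f x‖ ^ 2 ≤ ‖f‖ ^ 2 * I.length := by
  have hI : volume I.toSet ≠ ∞ := by rw [volume_toSet]; exact ENNReal.ofReal_ne_top
  rw [← L2.inner_indicatorConstLp_one (𝕜 := 𝕜) I.measurableSet_toSet hI f]
  calc _ ≤ (‖indicatorConstLp 2 I.measurableSet_toSet hI (1 : 𝕜)‖ * ‖f‖) ^ 2 := by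
        gcongr; exact norm_inner_le_norm _ _
    _ = _ := by
        rw [norm_indicatorConstLp (by norm_num) (by norm_num), volume_real_toSet, norm_one, one_mul,
          mul_pow, mul_comm, ENNReal.toReal_ofNat, ← Real.sqrt_eq_rpow,
          Real.sq_sqrt I.length_pos.le]

/-- Vanishing coefficients make the integrals over the two halves equal, so the integral doubles
from I to its parent. By Cauchy–Schwarz it can grow only like the square root of the length, so it
must be 0. -/
theorem setIntegral_toSet_eq_zero {f : Lp 𝕜 2 (volume : Measure ℝ)}
    (hf : ∀ I : DyadicInterval, haarCoeff f I = 0) (I : DyadicInterval) :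
    ∫ x in I.toSet, f x = 0 := by
  have hint := integrableOn_toSet (Lp.memLp f)
  have hhalf : ∀ I : DyadicInterval, ∫ x in I.leftHalf.toSet, f x = ∫ x in I.rightHalf.toSet, f x := by
    intro I
    have h1 := hf I
    rw [haarCoeff_eq (hint I), mul_eq_zero, sub_eq_zero] at h1
    refine h1.resolve_left (inv_ne_zero (RCLike.ofReal_ne_zero.2 ?_))
    exact (Real.sqrt_pos.2 I.length_pos).ne'
  have hpar : ∀ I : DyadicInterval, ‖∫ x in I.parent.toSet, f x‖ = 2 * ‖∫ x in I.toSet, f x‖ := by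
    intro I
    have h1 : ∫ x in I.parent.toSet, f x = (2 : 𝕜) * ∫ x in I.toSet, f x := by
      have h2 := hhalf I.parent
      rw [setIntegral_toSet_eq_halves (hint _)]
      rcases I.eq_half_parent with h | h <;>
        rw [show I.toSet = _ from congrArg toSet h, h2, two_mul]
    rw [h1, norm_mul, RCLike.norm_ofNat]
  have hlen : ∀ I : DyadicInterval, I.parent.length = 2 * I.length := by
    intro I
    have : I.length = I.parent.length / 2 := length_eq_of_k_succ (by simp [parent])
    linarith
  have key : ∀ (d : ℕ) (I : DyadicInterval),
      2 ^ d * ‖∫ x in I.toSet, f x‖ ^ 2 ≤ ‖f‖ ^ 2 * I.length := by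
    intro d
    induction d with
    | zero =>
      intro I
      rw [pow_zero, one_mul]
      exact norm_setIntegral_toSet_sq_le f I
    | succ d ih =>
      intro I
      have h1 := ih I.parent
      rw [hpar, hlen, mul_pow] at h1
      rw [pow_succ]
      linarith
  by_contra h
  have hpos : 0 < ‖∫ x in I.toSet, f x‖ ^ 2 := pow_pos (norm_pos_iff.2 h) 2
  obtain ⟨d, hd⟩ := pow_unbounded_of_one_lt (‖f‖ ^ 2 * I.length / ‖∫ x in I.toSet, f x‖ ^ 2)
    (one_lt_two (α := ℝ))
  rw [div_lt_iff₀ hpos] at hd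
  exact absurd (key d I) (not_le.2 hd)

theorem exists_mem_toSet (x : ℝ) (k : ℤ) : ∃ I : DyadicInterval, I.k = k ∧ x ∈ I.toSet := by
  set l : ℝ := (2 : ℝ) ^ (-k) with hl
  have hl0 : 0 < l := zpow_pos (by norm_num) _
  refine ⟨⟨k, ⌊x / l⌋⟩, rfl, ?_⟩
  have h1 := Int.floor_le (x / l)
  have h2 := Int.lt_floor_add_one (x / l)
  rw [le_div_iff₀ hl0] at h1
  rw [div_lt_iff₀ hl0] at h2
  simp only [toSet, right, left, length, ← hl]
  exact ⟨by linarith, by linarith⟩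

/-- The Haar system is complete. -/
theorem eq_zero_of_haarCoeff_eq_zero {f : Lp 𝕜 2 (volume : Measure ℝ)}
    (hf : ∀ I : DyadicInterval, haarCoeff f I = 0) : f = 0 := by
  have hloc : LocallyIntegrable f volume := (Lp.memLp f).locallyIntegrable (by norm_num)
  refine (Lp.eq_zero_iff_ae_eq_zero).2 ?_
  filter_upwards [IsUnifLocDoublingMeasure.ae_tendsto_average volume hloc 1] with x hx
  choose J hJk hJx using fun n : ℕ => exists_mem_toSet x n
  -- The differentiation theorem admits balls that contain x without being centred there; up to an
  -- endpoint these are the dyadic intervals around x.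
  have hball : ∀ n, Metric.closedBall (J n).mid ((J n).length / 2) = Icc (J n).left (J n).right := by
    intro n
    rw [Real.closedBall_eq_Icc]
    congr 1
    · rw [mid]; ring
    · rw [mid, right]; ring
  have hlen : ∀ n, (J n).length = (1 / 2 : ℝ) ^ n := by
    intro n
    rw [length, hJk, zpow_neg, zpow_natCast, one_div, inv_pow]
  have hδ : Tendsto (fun n => (J n).length / 2) atTop (𝓝[>] 0) := by
    refine tendsto_nhdsWithin_iff.2 ⟨?_, Eventually.of_forall fun n => half_pos (J n).length_pos⟩
    simp_rw [hlen]
    simpa using (tendsto_pow_atTop_nhds_zero_of_lt_one (r := (1 / 2 : ℝ)) (by norm_num)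
      (by norm_num)).div_const 2
  have h1 := hx (fun n => (J n).mid) _ hδ (Eventually.of_forall fun n => by
    rw [one_mul, hball]
    exact Ico_subset_Icc_self (hJx n))
  refine tendsto_nhds_unique h1 (tendsto_const_nhds.congr fun n => ?_)
  rw [hball, setAverage_eq, integral_Icc_eq_integral_Ico]
  have := setIntegral_toSet_eq_zero hf (J n)
  rw [toSet] at this
  rw [this, smul_zero]
  rfl

/-- The Haar system as a Hilbert basis of `L²(ℝ)`. -/
def haarBasis (𝕜 : Type*) [RCLike 𝕜] :
    HilbertBasis DyadicInterval 𝕜 (Lp 𝕜 2 (volume : Measure ℝ)) :=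
  HilbertBasis.mkOfOrthogonalEqBot orthonormal_haarLp (by
    rw [Submodule.eq_bot_iff]
    intro f hf
    refine eq_zero_of_haarCoeff_eq_zero fun I => ?_
    rw [← inner_haarLp]
    exact (Submodule.mem_orthogonal _ f).1 hf _ (Submodule.subset_span (mem_range_self I)))

/-! ### Haar multipliers and their bilinear forms -/

theorem integral_mul_eq_haarForm (f g : Lp 𝕜 2 (volume : Measure ℝ)) :
    ∫ x, f x * g x = haarForm univ (fun _ => 1) f g := by
  rw [integral_mul_eq_inner_star, ← (haarBasis 𝕜).tsum_inner_mul_inner, haarForm,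
    tsum_univ (fun I => (1 : 𝕜) * haarCoeff f I * haarCoeff g I)]
  refine tsum_congr fun I => ?_
  rw [haarBasis, HilbertBasis.coe_mkOfOrthogonalEqBot, inner_haarLp, inner_star_haarLp, one_mul,
    mul_comm]

theorem summable_haarCoeff_sq (f : Lp 𝕜 2 (volume : Measure ℝ)) :
    Summable fun I => ‖haarCoeff f I‖ ^ 2 := by
  simpa only [inner_haarLp] using orthonormal_haarLp.inner_products_summable f

theorem summable_haarMultiplier {𝓘 : Set DyadicInterval} {ε : DyadicInterval → 𝕜} {A : ℝ}
    (hε : ∀ I ∈ 𝓘, ‖ε I‖ ≤ A) (f : Lp 𝕜 2 (volume : Measure ℝ)) :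
    Summable fun I : 𝓘 => (ε I * haarCoeff f I) • haarLp 𝕜 (I : DyadicInterval) := by
  have ho : Orthonormal 𝕜 fun I : 𝓘 => haarLp 𝕜 (I : DyadicInterval) :=
    orthonormal_haarLp.comp _ Subtype.val_injective
  have h1 := (ho.orthogonalFamily.summable_iff_norm_sq_summable
    fun I : 𝓘 => ε I * haarCoeff f I).2 ?_
  · simpa only [LinearIsometry.toSpanSingleton_apply] using h1
  · refine Summable.of_nonneg_of_le (fun I => by positivity) (fun I => ?_)
      (((summable_haarCoeff_sq f).comp_injective
        (Subtype.val_injective (p := (· ∈ 𝓘)))).mul_left (A ^ 2))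
    rw [norm_mul, mul_pow]
    simp only [Function.comp_apply]
    gcongr
    exact hε I I.2

/-- The series is the image of the multiplier series under the continuous functional u ↦ ∫ u g. For
scalars, summability is absolute convergence. -/
theorem summable_haarForm {𝓘 : Set DyadicInterval} {ε : DyadicInterval → 𝕜} {A : ℝ}
    (hε : ∀ I ∈ 𝓘, ‖ε I‖ ≤ A) (f g : Lp 𝕜 2 (volume : Measure ℝ)) :
    Summable fun I : 𝓘 => ε I * haarCoeff f I * haarCoeff g I := by
  refine ((summable_haarMultiplier hε f).mapL (innerSL 𝕜 (star g))).congr fun I => ?_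
  rw [innerSL_apply_apply, inner_smul_right, inner_star_haarLp]

theorem integral_haarMultiplier_mul {𝓘 : Set DyadicInterval} {ε : DyadicInterval → 𝕜} {A : ℝ}
    (hε : ∀ I ∈ 𝓘, ‖ε I‖ ≤ A) (f g : Lp 𝕜 2 (volume : Measure ℝ)) :
    ∫ x, haarMultiplier 𝓘 ε f x * g x = haarForm 𝓘 ε f g := by
  rw [integral_mul_eq_inner_star, ← innerSL_apply_apply 𝕜, haarMultiplier,
    (innerSL 𝕜 (star g)).map_tsum (summable_haarMultiplier hε f), haarForm]
  refine tsum_congr fun I => ?_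
  rw [innerSL_apply_apply, inner_smul_right, inner_star_haarLp]

theorem exists_isSparseSum_haarForm {η : ℝ} (hη : 0 < η) (hη1 : η < 1) {𝓘 : Set DyadicInterval}
    {ε : DyadicInterval → 𝕜} {A : ℝ} (hε : ∀ I ∈ 𝓘, ‖ε I‖ ≤ A) (hA : 0 ≤ A)
    (f g : Lp 𝕜 2 (volume : Measure ℝ)) :
    ∃ s, IsSparseSum η (fun I => osc f I.toSet * osc g I.toSet * I.length) univ s ∧
      ‖haarForm 𝓘 ε f g‖ ≤ 2 * (2 * (2 / (1 - η))) ^ 2 * A * s := by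
  by_cases h0 : haarForm 𝓘 ε f g = 0
  · exact ⟨0, IsSparseSum.empty _ _ _, by simp [h0]⟩
  have hlim := (summable_haarForm hε f g).hasSum.norm
  -- Settling for half of |Λ| leaves a finite sum; this is the leading 2 in the constant.
  have hlt : ‖haarForm 𝓘 ε f g‖ / 2 < ‖haarForm 𝓘 ε f g‖ := half_lt_self (norm_pos_iff.2 h0)
  obtain ⟨F, hF⟩ := (hlim.eventually (lt_mem_nhds hlt)).exists
  obtain ⟨s, hs, hs'⟩ := exists_isSparseSum_sum hη hη1 (integrableOn_toSet (Lp.memLp f))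
    (integrableOn_toSet (Lp.memLp g)) (F.map (Function.Embedding.subtype _))
  refine ⟨s, hs, ?_⟩
  rw [Finset.sum_map] at hs'
  have h1 : ‖∑ I ∈ F, ε I * haarCoeff f I * haarCoeff g I‖ ≤
      A * ∑ I ∈ F, ‖haarCoeff f I‖ * ‖haarCoeff g I‖ := by
    rw [Finset.mul_sum]
    refine norm_sum_le_of_le _ fun I _ => ?_
    rw [norm_mul, norm_mul, mul_assoc]
    gcongr
    exact hε I I.2
  have h2 := h1.trans (mul_le_mul_of_nonneg_left hs' hA)
  linarith

/-! ### Passage to the sharp maximal function -/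

theorem ofReal_osc_le_sharpMax (f : ℝ → 𝕜) {Q : DyadicInterval} {x : ℝ} (hx : x ∈ Q.toSet) :
    ENNReal.ofReal (osc f Q.toSet) ≤ sharpMax f x := by
  have h1 : osc f Q.toSet = osc f (Icc Q.left Q.right) := by
    rw [osc, osc, toSet, restrict_Ico_eq_restrict_Icc]
  rw [h1, sharpMax]
  exact le_iSup_of_le Q.left (le_iSup_of_le Q.right (le_iSup_of_le Q.left_lt_right
    (le_iSup_of_le (Ico_subset_Icc_self hx) le_rfl)))

/-- Sparseness gives |Q| ≤ 2|E_Q|, each term is then at most twice the integral over E_Q, and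
disjointness adds these up. -/
theorem ofReal_isSparseSum_le {f g : ℝ → 𝕜} {V : Set ℝ} {s : ℝ}
    (hs : IsSparseSum (1 / 2) (fun I => osc f I.toSet * osc g I.toSet * I.length) V s) :
    ENNReal.ofReal s ≤ 2 * ∫⁻ x, sharpMax f x * sharpMax g x := by
  obtain ⟨S, E, hE, hEd, rfl⟩ := hs
  have hterm : ∀ Q ∈ S, ENNReal.ofReal (osc f Q.toSet * osc g Q.toSet * Q.length) ≤
      2 * ∫⁻ x in E Q, sharpMax f x * sharpMax g x := by
    intro Q hQ
    obtain ⟨-, hm, hsub, hvol⟩ := hE Q hQ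
    have hlen : ENNReal.ofReal Q.length ≤ 2 * volume (E Q) := by
      calc ENNReal.ofReal Q.length = 2 * ENNReal.ofReal (1 / 2 * Q.length) := by
            rw [← ENNReal.ofReal_ofNat 2, ← ENNReal.ofReal_mul (by norm_num)]
            congr 1; ring
        _ ≤ _ := by gcongr
    have hle : ENNReal.ofReal (osc f Q.toSet) * ENNReal.ofReal (osc g Q.toSet) * volume (E Q) ≤
        ∫⁻ x in E Q, sharpMax f x * sharpMax g x := by
      rw [← setLIntegral_const]
      exact setLIntegral_mono' hm fun x hx => mul_le_mul' (ofReal_osc_le_sharpMax f (hsub hx))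
        (ofReal_osc_le_sharpMax g (hsub hx))
    rw [ENNReal.ofReal_mul (mul_nonneg (osc_nonneg _ _) (osc_nonneg _ _)),
      ENNReal.ofReal_mul (osc_nonneg _ _)]
    calc _ ≤ ENNReal.ofReal (osc f Q.toSet) * ENNReal.ofReal (osc g Q.toSet) *
          (2 * volume (E Q)) := by gcongr
      _ = 2 * (ENNReal.ofReal (osc f Q.toSet) * ENNReal.ofReal (osc g Q.toSet) *
          volume (E Q)) := by ring
      _ ≤ _ := by gcongr
  rw [ENNReal.ofReal_sum_of_nonneg fun Q _ =>
    mul_nonneg (mul_nonneg (osc_nonneg _ _) (osc_nonneg _ _)) Q.length_pos.le]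
  calc _ ≤ ∑ Q ∈ S, 2 * ∫⁻ x in E Q, sharpMax f x * sharpMax g x := Finset.sum_le_sum hterm
    _ = 2 * ∫⁻ x in ⋃ Q ∈ S, E Q, sharpMax f x * sharpMax g x := by
        rw [lintegral_biUnion_finset hEd fun Q hQ => (hE Q hQ).2.1, Finset.mul_sum]
    _ ≤ _ := by gcongr; exact Measure.restrict_le_self

end HaarSparse

end

theorem proposition8p3 {𝕜 : Type*} [RCLike 𝕜] :
    (∀ η : ℝ, 0 < η → η < 1 → ∃ C : ℝ, 0 < C ∧
      ∀ (𝓘 : Set HaarSparse.DyadicInterval) (ε : HaarSparse.DyadicInterval → 𝕜) (A : ℝ),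
        (∀ I ∈ 𝓘, ‖ε I‖ ≤ A) → 0 ≤ A →
        ∀ f g : Lp 𝕜 2 (volume : Measure ℝ),
          Summable (fun I : 𝓘 =>
            (ε I * HaarSparse.haarCoeff f I) •
              HaarSparse.haarLp 𝕜 (I : HaarSparse.DyadicInterval)) ∧
          Summable (fun I : 𝓘 =>
            ε I * HaarSparse.haarCoeff f I * HaarSparse.haarCoeff g I) ∧
          ∫ x, HaarSparse.haarMultiplier 𝓘 ε f x * g x = HaarSparse.haarForm 𝓘 ε f g ∧
          ∃ 𝓢 : Set HaarSparse.DyadicInterval, HaarSparse.IsSparse η 𝓢 ∧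
            Summable (fun Q : 𝓢 =>
              HaarSparse.osc f (Q : HaarSparse.DyadicInterval).toSet *
                HaarSparse.osc g (Q : HaarSparse.DyadicInterval).toSet *
                (Q : HaarSparse.DyadicInterval).length) ∧
            ‖HaarSparse.haarForm 𝓘 ε f g‖ ≤ C * A * ∑' Q : 𝓢,
              HaarSparse.osc f (Q : HaarSparse.DyadicInterval).toSet *
                HaarSparse.osc g (Q : HaarSparse.DyadicInterval).toSet *
                (Q : HaarSparse.DyadicInterval).length) ∧
    (∃ C : ℝ, 0 < C ∧ ∀ f g : Lp 𝕜 2 (volume : Measure ℝ),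
      ENNReal.ofReal ‖∫ x, f x * g x‖ ≤
        ENNReal.ofReal C * ∫⁻ x, HaarSparse.sharpMax f x * HaarSparse.sharpMax g x) := by
  constructor
  · intro η hη hη1
    have hη' : 0 < 1 - η := by linarith
    refine ⟨2 * (2 * (2 / (1 - η))) ^ 2, by positivity, fun 𝓘 ε A hε hA f g =>
      ⟨HaarSparse.summable_haarMultiplier hε f, HaarSparse.summable_haarForm hε f g,
        HaarSparse.integral_haarMultiplier_mul hε f g, ?_⟩⟩
    obtain ⟨s, ⟨S, E, hE, hEd, rfl⟩, hs⟩ :=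
      HaarSparse.exists_isSparseSum_haarForm hη hη1 hε hA f g
    refine ⟨S, ⟨E, fun Q hQ => (hE Q hQ).2, hEd⟩, Summable.of_finite, ?_⟩
    rwa [Finset.tsum_subtype' S fun Q : HaarSparse.DyadicInterval =>
      HaarSparse.osc f Q.toSet * HaarSparse.osc g Q.toSet * Q.length]
  -- At η = 1/2 the form bound is 2 · (2 · 4)² = 128; passing from |Q| to |E_Q| doubles it.
  · refine ⟨256, by norm_num, fun f g => ?_⟩
    obtain ⟨s, hs, hle⟩ := HaarSparse.exists_isSparseSum_haarForm (η := 1 / 2) (by norm_num)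
      (by norm_num) (𝓘 := univ) (ε := fun _ => (1 : 𝕜)) (A := 1) (by simp) zero_le_one f g
    rw [HaarSparse.integral_mul_eq_haarForm]
    calc _ ≤ ENNReal.ofReal (128 * s) := ENNReal.ofReal_le_ofReal (hle.trans_eq (by norm_num))
      _ = ENNReal.ofReal 128 * ENNReal.ofReal s := ENNReal.ofReal_mul (by norm_num)
      _ ≤ ENNReal.ofReal 128 * (2 * ∫⁻ x, HaarSparse.sharpMax f x * HaarSparse.sharpMax g x) := by
          gcongr
          exact HaarSparse.ofReal_isSparseSum_le hs
      _ = _ := by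
          have h : ENNReal.ofReal 128 * 2 = ENNReal.ofReal 256 := by
            rw [← ENNReal.ofReal_ofNat 2, ← ENNReal.ofReal_mul (by norm_num)]
            norm_num
          rw [← mul_assoc, h]
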